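/- For complex $a,b,c,q,z$ write $(a;q)_n=\prod_{k=0}^{n-1}(1-aq^k)$ and $${}_2\phi_1(a,b;c;q;z)=\sum_{n=0}^{\infty}\frac{(a;q)_n(b;q)_n}{(c;q)_n(q;q)_n}z^n .$$ A continued fraction $\beta_0+\mathop{K}_{n\ge1}(\alpha_n/\beta_n)$ with $\alpha_n,\beta_n\in\mathbb C$ converges to $f\in\hat{\mathbb C}=\mathbb C\cup\{\infty\}$ if its approximants $f_n=\beta_0+\cfrac{\alpha_1}{\beta_1+\cdots+\cfrac{\alpha_n}{\beta_n}}$, computed in $\hat{\mathbb C}$, tend to $f$ in $\hat{\mathbb C}$; if some $\alpha_n$ vanishes, the continued fraction terminates before the first such term. **Theorem.** Let $a,b,c,q,z\in\mathbb C$ with $b\neq0$, $|q|<1$, $|z|<1$, $|c/b|<1$ and $cq^n\ne1$ for all $n\ge0$. Then the series ${}_2\phi_1(a,b;c;q;z)$ and ${}_2\phi_1(a,bq;cq;q;z)$ converge absolutely, and, provided that their sums are not both $0$ (which is automatic if no partial numerator of the continued fraction below vanishes), $$\frac{{}_2\phi_1(a,b;c;q;z)}{{}_2\phi_1(a,bq;cq;q;z)}=\beta_0+\mathop{K}_{n=1}^{\infty}\frac{\alpha_n}{\beta_n}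 =\frac{1-bz}{1-c}+\cfrac{(c-abz)(z-1)}{(1-c)(1-bzq)+\cfrac{(1-c)(1-bq)(cq-a)z}{1-bzq^2+\cfrac{(c-abzq)(zq-1)q}{1-bzq^3+\cfrac{(1-bq^2)(cq^2-a)zq}{1-bzq^4+\cdots}}}}$$ in the sense that the continued fraction converges in $\hat{\mathbb C}$ to the left side (which is $\infty$ when the denominator is $0$). Here $\beta_0=\frac{1-bz}{1-c}$, $\beta_1=(1-c)(1-bzq)$, $\beta_n=1-bzq^n$ for $n\ge2$; $\alpha_{2k+1}=(c-abzq^k)(zq^k-1)q^k$ for $k\ge0$; $\alpha_2=(1-c)(1-bq)(cq-a)z$ and $\alpha_{2k}=(1-bq^k)(cq^k-a)zq^{k-1}$ for $k\ge2$. -/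

import Mathlib

open scoped Topology

noncomputable section

namespace HeineCF

/-- The `q`-shifted factorial `(a; q)_n = ∏_{k < n} (1 - a q ^ k)`. -/
def qPoch (a q : ℂ) (n : ℕ) : ℂ := ∏ k ∈ Finset.range n, (1 - a * q ^ k)

/-- The `n`-th term of the basic hypergeometric series `₂φ₁(a, b; c; q; z)`. -/
def phiTerm (a b c q z : ℂ) (n : ℕ) : ℂ :=
  qPoch a q n * qPoch b q n / (qPoch c q n * qPoch q q n) * z ^ n

/-- The basic hypergeometric series `₂φ₁(a, b; c; q; z)`. -/
def phi (a b c q z : ℂ) : ℂ := ∑' n : ℕ, phiTerm a b c q z n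

/-- The quotient `x / y` as a point of the Riemann sphere `ℂ ∪ {∞}`
(meaningful when `x` and `y` are not both zero). -/
def sphereDiv (x y : ℂ) : OnePoint ℂ :=
  if y = 0 then OnePoint.infty else ((x / y : ℂ) : OnePoint ℂ)

/-- The map `w ↦ α / (β + w)` of the Riemann sphere to itself. For `α = 0` it is constantly `0`,
so that a continued fraction terminates at its first vanishing partial numerator. -/
def step (α β : ℂ) : OnePoint ℂ → OnePoint ℂ
  | none => ((0 : ℂ) : OnePoint ℂ)
  | some w => if α = 0 then ((0 : ℂ) : OnePoint ℂ) else sphereDiv α (β + w)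

/-- The composition `S_n(w) = β₀ + α₁ / (β₁ + α₂ / (β₂ + ⋯ + α_n / (β_n + w)))`
on the Riemann sphere, with `S_n(w) = S_{n-1}(s_n(w))`, `s_n(w) = α_n / (β_n + w)`.
The value `α 0` is not used. -/
def cfMap (α β : ℕ → ℂ) : ℕ → OnePoint ℂ → OnePoint ℂ
  | 0, w => OnePoint.map (fun x : ℂ => β 0 + x) w
  | n + 1, w => cfMap α β n (step (α (n + 1)) (β (n + 1)) w)

/-- The `n`-th approximant of the continued fraction `β₀ + K_{n ≥ 1} (α_n / β_n)`. -/
def approximant (α β : ℕ → ℂ) (n : ℕ) : OnePoint ℂ := cfMap α β n ((0 : ℂ) : OnePoint ℂ)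

/-- The continued fraction `β₀ + K_{n ≥ 1} (α_n / β_n)` converges to `f` in the Riemann sphere. -/
def CFConvergesTo (α β : ℕ → ℂ) (f : OnePoint ℂ) : Prop :=
  Filter.Tendsto (approximant α β) Filter.atTop (𝓝 f)

/-- Partial numerators (used for `n ≥ 1`):
`α_{2k+1} = (c - a b z q^k) (z q^k - 1) q^k` for `k ≥ 0`,
`α_{2k} = (1 - b q^k) (c q^k - a) z q^{k-1}` for `k ≥ 2`,
and `α_2 = (1 - c) (1 - b q) (c q - a) z`. -/
def partialNum (a b c q z : ℂ) (n : ℕ) : ℂ :=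
  if n % 2 = 1 then
    (c - a * b * z * q ^ (n / 2)) * (z * q ^ (n / 2) - 1) * q ^ (n / 2)
  else
    (if n = 2 then 1 - c else 1) *
      ((1 - b * q ^ (n / 2)) * (c * q ^ (n / 2) - a) * z * q ^ (n / 2 - 1))

/-- Partial denominators: `β_0 = (1 - b z) / (1 - c)`, `β_1 = (1 - c) (1 - b z q)` and
`β_n = 1 - b z q^n` for `n ≥ 2`. -/
def partialDen (b c q z : ℂ) : ℕ → ℂ
  | 0 => (1 - b * z) / (1 - c)
  | 1 => (1 - c) * (1 - b * z * q)
  | n + 2 => 1 - b * z * q ^ (n + 2)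

end HeineCF

end

/-! This is a Pincherle-type argument. Suppose `Z n = β n * Z (n+1) + α (n+1) * Z (n+2)`, and write
A_n, B_n for the Wallis numerators and denominators. Unrolling gives Z_0 = A_n Z_{n+1} + α_{n+1}
A_{n-1} Z_{n+2}, and likewise Z_1 with B (`wallis_expand`). If ∑(|β_n - 1| + |α_n|) converges, then
A and B are bounded (`wallis_bounded`). If moreover Z tends to L ≠ 0, the second summands vanish in
the limit, so A_n Z_{n+1} → Z_0 and B_n Z_{n+1} → Z_1. The factor Z_{n+1} cancels in the quotient,
hence A_n / B_n → Z_0 / Z_1 on the sphere unless Z_0 = Z_1 = 0 (`cfConvergesTo_of_tail`).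

For Heine's fraction, Z is built from series with b, c, z multiplied by powers of q. Two contiguous
relations (`phi_contiguous_left`, `phi_contiguous_right`) give the recurrence; division by q-shifted
factorials brings it to the required coefficients. The shifted series tend to 1, so Z tends to 1 /
((c;q)_∞ (z;q)_∞), which is finite and nonzero. -/

namespace HeineCF

open Filter

/-! ### Wallis recurrences and convergence on the Riemann sphere -/

/-- Solution of `w (n + 2) = β (n + 1) * w (n + 1) + α (n + 1) * w n` with given initial values. -/
def wallis (α β : ℕ → ℂ) (x y : ℂ) : ℕ → ℂ
  | 0 => x
  | 1 => y
  | n + 2 => β (n + 1) * wallis α β x y (n + 1) + α (n + 1) * wallis α β x y n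

lemma sphereDiv_mul_right (x y : ℂ) {t : ℂ} (ht : t ≠ 0) :
    sphereDiv (x * t) (y * t) = sphereDiv x y := by
  unfold sphereDiv
  by_cases hy : y = 0
  · simp [hy]
  · simp [hy, ht, mul_div_mul_right]

lemma tendsto_sphereDiv {x y : ℕ → ℂ} {X Y : ℂ} (hx : Tendsto x atTop (𝓝 X))
    (hy : Tendsto y atTop (𝓝 Y)) (h : X ≠ 0 ∨ Y ≠ 0) :
    Tendsto (fun n => sphereDiv (x n) (y n)) atTop (𝓝 (sphereDiv X Y)) := by
  by_cases hY : Y = 0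
  · have hX : X ≠ 0 := h.resolve_right (not_not.mpr hY)
    subst hY
    have : sphereDiv X 0 = OnePoint.infty := if_pos rfl
    rw [this, OnePoint.hasBasis_nhds_infty.tendsto_right_iff]
    -- If s lies in the disc of radius R, then x/y ∈ s forces |x| ≤ R|y|; but |x| - R|y| tends to
    -- |X| > 0.
    rintro s ⟨-, hs⟩
    obtain ⟨R, hR⟩ := hs.isBounded.exists_norm_le
    have h1 : Tendsto (fun n => ‖x n‖ - R * ‖y n‖) atTop (𝓝 (‖X‖ - R * ‖(0 : ℂ)‖)) :=
      hx.norm.sub (hy.norm.const_mul R)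
    have h2 : 0 < ‖X‖ - R * ‖(0 : ℂ)‖ := by simpa using hX
    filter_upwards [h1.eventually (lt_mem_nhds h2)] with n hn
    by_cases hyn : y n = 0
    · right; simp [sphereDiv, hyn]
    · left
      refine ⟨x n / y n, fun hmem => ?_, by simp [sphereDiv, hyn]⟩
      have := hR _ hmem
      rw [norm_div, div_le_iff₀ (norm_pos_iff.mpr hyn)] at this
      linarith
  · have : sphereDiv X Y = ((X / Y : ℂ) : OnePoint ℂ) := if_neg hY
    rw [this]
    refine ((OnePoint.continuous_coe.tendsto _).comp (hx.div hy hY)).congr' ?_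
    filter_upwards [hy.eventually_ne hY] with n hn
    simp [sphereDiv, hn]

lemma step_sphereDiv {α : ℂ} (β : ℂ) (hα : α ≠ 0) {x y : ℂ} (h : x ≠ 0 ∨ y ≠ 0) :
    step α β (sphereDiv x y) = sphereDiv (α * y) (β * y + x) := by
  by_cases hy : y = 0
  · have hx : x ≠ 0 := h.resolve_right (not_not.mpr hy)
    subst hy
    simp only [sphereDiv, if_true, mul_zero, zero_add, if_neg hx, zero_div]
    rfl
  · have h1 : sphereDiv x y = some (x / y) := if_neg hy
    have h2 : step α β (some (x / y)) = sphereDiv α (β + x / y) := if_neg hα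
    rw [h1, h2, ← sphereDiv_mul_right α _ hy]
    congr 1
    field_simp

/-- In homogeneous coordinates each step with α ≠ 0 is an invertible linear map, so the composition
is a matrix product. Indices are shifted by one: `wallis` at n + 1 is A_n or B_n, and index 0 holds
A_{-1} = 1, B_{-1} = 0. -/
lemma cfMap_sphereDiv {α β : ℕ → ℂ} (n : ℕ) (hα : ∀ k, 1 ≤ k → k ≤ n → α k ≠ 0)
    {x y : ℂ} (h : x ≠ 0 ∨ y ≠ 0) :
    cfMap α β n (sphereDiv x y) =
      sphereDiv (wallis α β 1 (β 0) (n + 1) * y + wallis α β 1 (β 0) n * x)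
        (wallis α β 0 1 (n + 1) * y + wallis α β 0 1 n * x) := by
  induction n generalizing x y with
  | zero =>
    by_cases hy : y = 0
    · subst hy
      simp [cfMap, wallis, sphereDiv]
    · simp only [cfMap, wallis, sphereDiv, if_neg hy, one_mul, zero_mul, add_zero,
        OnePoint.map_some]
      congr 1
      field_simp
  | succ n ih =>
    have hn := hα (n + 1) (by omega) le_rfl
    have h' : α (n + 1) * y ≠ 0 ∨ β (n + 1) * y + x ≠ 0 := by
      by_cases hy : y = 0
      · right; simpa [hy] using h
      · left; exact mul_ne_zero hn hy
    rw [cfMap, step_sphereDiv _ hn h, ih (fun k h1 h2 => hα k h1 (by omega)) h']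
    simp only [wallis]
    congr 1 <;> ring

lemma approximant_eq_sphereDiv {α β : ℕ → ℂ} (n : ℕ) (hα : ∀ k, 1 ≤ k → k ≤ n → α k ≠ 0) :
    approximant α β n =
      sphereDiv (wallis α β 1 (β 0) (n + 1)) (wallis α β 0 1 (n + 1)) := by
  have h0 : ((0 : ℂ) : OnePoint ℂ) = sphereDiv 0 1 := by simp [sphereDiv]
  rw [approximant, h0, cfMap_sphereDiv n hα (Or.inr one_ne_zero)]
  simp

/-- The step with vanishing numerator is constantly 0, so nothing beyond it affects the value. -/
lemma cfMap_of_partialNum_eq_zero {α : ℕ → ℂ} (β : ℕ → ℂ) {m : ℕ} (hm : α (m + 1) = 0) (n : ℕ)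
    (w : OnePoint ℂ) : cfMap α β (m + 1 + n) w = approximant α β m := by
  induction n generalizing w with
  | zero =>
    have : step (α (m + 1)) (β (m + 1)) w = ((0 : ℂ) : OnePoint ℂ) := by
      cases w with
      | infty => rfl
      | coe w => exact if_pos hm
    rw [add_zero, cfMap, this, approximant]
  | succ n ih => rw [← add_assoc, cfMap, ih]

/-- A solution `Z` of the backward recurrence is expanded along the Wallis recurrence. -/
lemma wallis_expand {α β Z : ℕ → ℂ} (hZ : ∀ n, Z n = β n * Z (n + 1) + α (n + 1) * Z (n + 2))
    (n : ℕ) :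
    Z 0 = wallis α β 1 (β 0) (n + 1) * Z (n + 1) + α (n + 1) * wallis α β 1 (β 0) n * Z (n + 2) ∧
    Z 1 = wallis α β 0 1 (n + 1) * Z (n + 1) + α (n + 1) * wallis α β 0 1 n * Z (n + 2) := by
  induction n with
  | zero => simp [wallis, hZ 0]
  | succ n ih =>
    obtain ⟨h0, h1⟩ := ih
    rw [hZ (n + 1)] at h0 h1
    simp only [wallis]
    constructor
    · refine h0.trans ?_
      ring
    · refine h1.trans ?_
      ring

/-- The larger of two consecutive norms has a majorant that grows by at most the factor 1 + ε_n per
step, and ∏(1 + ε_n) ≤ exp ∑ ε_n. -/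
lemma wallis_bounded {α β : ℕ → ℂ} (x y : ℂ)
    (h : Summable fun n => ‖β (n + 1) - 1‖ + ‖α (n + 1)‖) :
    ∃ K, ∀ n, ‖wallis α β x y n‖ ≤ K := by
  set ε : ℕ → ℝ := fun n => ‖β (n + 1) - 1‖ + ‖α (n + 1)‖ with hε
  have hε0 : ∀ n, 0 ≤ ε n := fun n => by positivity
  set M := max ‖x‖ ‖y‖
  have hM : 0 ≤ M := (norm_nonneg x).trans (le_max_left _ _)
  have key : ∀ n, ‖wallis α β x y n‖ ≤ M * ∏ k ∈ Finset.range n, (1 + ε k) ∧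
      ‖wallis α β x y (n + 1)‖ ≤ M * ∏ k ∈ Finset.range n, (1 + ε k) := by
    intro n
    induction n with
    | zero => simp [wallis, M]
    | succ n ih =>
      obtain ⟨h0, h1⟩ := ih
      rw [Finset.prod_range_succ]
      set T := M * ∏ k ∈ Finset.range n, (1 + ε k)
      have hT : 0 ≤ T := (norm_nonneg _).trans h0
      have e : M * ((∏ k ∈ Finset.range n, (1 + ε k)) * (1 + ε n)) = T * (1 + ε n) := by ring
      rw [e]
      refine ⟨h1.trans (by nlinarith [hε0 n]), ?_⟩
      have e2 : wallis α β x y (n + 1 + 1) = wallis α β x y (n + 1)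
          + ((β (n + 1) - 1) * wallis α β x y (n + 1) + α (n + 1) * wallis α β x y n) := by
        simp only [wallis]; ring
      rw [e2]
      calc _ ≤ ‖wallis α β x y (n + 1)‖ + (‖β (n + 1) - 1‖ * ‖wallis α β x y (n + 1)‖
              + ‖α (n + 1)‖ * ‖wallis α β x y n‖) := by
            refine (norm_add_le _ _).trans (add_le_add_right ?_ _)
            refine (norm_add_le _ _).trans ?_
            rw [norm_mul, norm_mul]
        _ ≤ T + (‖β (n + 1) - 1‖ * T + ‖α (n + 1)‖ * T) := by gcongr
        _ = T * (1 + ε n) := by simp only [hε]; ring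
  refine ⟨M * Real.exp (∑' n, ε n), fun n => (key n).1.trans ?_⟩
  refine mul_le_mul_of_nonneg_left ?_ hM
  exact (Real.prod_one_add_le_exp_sum _ fun i => hε0 i).trans
    (Real.exp_le_exp.mpr (h.sum_le_tsum _ fun i _ => hε0 i))

/-- If the backward recurrence has a solution `Z` with nonzero limit and the coefficients converge
summably to `α = 0`, `β = 1`, the continued fraction converges to `Z 0 / Z 1`. -/
theorem cfConvergesTo_of_tail {α β Z : ℕ → ℂ} {L : ℂ}
    (hZ : ∀ n, Z n = β n * Z (n + 1) + α (n + 1) * Z (n + 2))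
    (hL : Tendsto Z atTop (𝓝 L)) (hL0 : L ≠ 0)
    (hs : Summable fun n => ‖β (n + 1) - 1‖ + ‖α (n + 1)‖) (h0 : Z 0 ≠ 0 ∨ Z 1 ≠ 0) :
    CFConvergesTo α β (sphereDiv (Z 0) (Z 1)) := by
  by_cases hα : ∀ n, α (n + 1) ≠ 0
  · have hα' : ∀ k, 1 ≤ k → α k ≠ 0 := fun k hk => by
      obtain ⟨k, rfl⟩ := Nat.exists_eq_add_of_le' hk
      exact hα k
    have hα0 : Tendsto (fun n => α (n + 1)) atTop (𝓝 0) := by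
      refine squeeze_zero_norm (fun n => ?_) hs.tendsto_atTop_zero
      linarith [norm_nonneg (β (n + 1) - 1)]
    have lim : ∀ x y z : ℂ, (∀ n, z = wallis α β x y (n + 1) * Z (n + 1)
        + α (n + 1) * wallis α β x y n * Z (n + 2)) →
        Tendsto (fun n => wallis α β x y (n + 1) * Z (n + 1)) atTop (𝓝 z) := by
      intro x y z hz
      obtain ⟨K, hK⟩ := wallis_bounded x y hs
      have h1 : Tendsto (fun n => α (n + 1) * wallis α β x y n) atTop (𝓝 0) := by
        refine squeeze_zero_norm (a := fun n => ‖α (n + 1)‖ * K) (fun n => ?_) ?_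
        · rw [norm_mul]
          exact mul_le_mul_of_nonneg_left (hK n) (norm_nonneg _)
        · simpa using hα0.norm.mul_const K
      have h2 := h1.mul (hL.comp (tendsto_add_atTop_nat 2))
      have h3 := (tendsto_const_nhds (x := z)).sub h2
      rw [zero_mul, sub_zero] at h3
      refine h3.congr fun n => ?_
      simp only [Function.comp_apply]
      linear_combination hz n
    have t := tendsto_sphereDiv (lim _ _ _ fun n => (wallis_expand hZ n).1)
      (lim _ _ _ fun n => (wallis_expand hZ n).2) h0
    refine t.congr' ?_
    filter_upwards [(hL.comp (tendsto_add_atTop_nat 1)).eventually_ne hL0] with n hn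
    rw [Function.comp_apply] at hn
    rw [sphereDiv_mul_right _ _ hn, approximant_eq_sphereDiv n fun k h1 _ => hα' k h1]
  · push Not at hα
    classical
    obtain ⟨m, hm, hmin⟩ : ∃ m, α (m + 1) = 0 ∧ ∀ k < m, α (k + 1) ≠ 0 :=
      ⟨Nat.find hα, Nat.find_spec hα, fun k hk => Nat.find_min hα hk⟩
    obtain ⟨e0, e1⟩ := wallis_expand hZ m
    rw [hm] at e0 e1
    simp only [zero_mul, add_zero] at e0 e1
    -- At termination the expansion is exact: Z_0 = A_m Z_{m+1} and Z_1 = B_m Z_{m+1}.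
    have hZm : Z (m + 1) ≠ 0 := by
      intro h
      rw [h, mul_zero] at e0 e1
      exact h0.elim (· e0) (· e1)
    have happ : approximant α β m = sphereDiv (Z 0) (Z 1) := by
      rw [e0, e1, sphereDiv_mul_right _ _ hZm]
      refine approximant_eq_sphereDiv m fun k h1 h2 => ?_
      obtain ⟨k, rfl⟩ := Nat.exists_eq_add_of_le' h1
      exact hmin k (by omega)
    rw [← happ]
    refine tendsto_const_nhds.congr' ?_
    filter_upwards [eventually_ge_atTop (m + 1)] with n hn
    obtain ⟨k, rfl⟩ := Nat.exists_eq_add_of_le hn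
    exact (cfMap_of_partialNum_eq_zero β hm k _).symm

/-- With nonzero α, two consecutive zeros propagate forward and force the limit to be 0. -/
lemma tail_ne_zero {α β Z : ℕ → ℂ} {L : ℂ}
    (hZ : ∀ n, Z n = β n * Z (n + 1) + α (n + 1) * Z (n + 2))
    (hL : Tendsto Z atTop (𝓝 L)) (hL0 : L ≠ 0) (hα : ∀ n, α (n + 1) ≠ 0) :
    Z 0 ≠ 0 ∨ Z 1 ≠ 0 := by
  by_contra! h
  have key : ∀ n, Z n = 0 ∧ Z (n + 1) = 0 := by
    intro n
    induction n with
    | zero => exact h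
    | succ n ih =>
      refine ⟨ih.2, ?_⟩
      have := hZ n
      rw [ih.1, ih.2, mul_zero, zero_add] at this
      exact (mul_eq_zero.mp this.symm).resolve_left (hα n)
  exact hL0 (tendsto_nhds_unique hL (tendsto_const_nhds.congr fun n => (key n).1.symm))

/-! ### The `q`-shifted factorial -/

@[simp] lemma qPoch_zero (a q : ℂ) : qPoch a q 0 = 1 := by simp [qPoch]

lemma qPoch_succ (a q : ℂ) (n : ℕ) : qPoch a q (n + 1) = qPoch a q n * (1 - a * q ^ n) :=
  Finset.prod_range_succ _ _

lemma qPoch_succ' (a q : ℂ) (n : ℕ) : qPoch a q (n + 1) = (1 - a) * qPoch (a * q) q n := by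
  simp only [qPoch, Finset.prod_range_succ']
  rw [mul_comm]
  congr 1
  · simp
  · exact Finset.prod_congr rfl fun k _ => by ring

lemma qPoch_add (a q : ℂ) (k n : ℕ) :
    qPoch a q (k + n) = qPoch a q k * qPoch (a * q ^ k) q n := by
  simp only [qPoch, Finset.prod_range_add]
  congr 1
  exact Finset.prod_congr rfl fun j _ => by ring

lemma qPoch_ne_zero {c q : ℂ} (hc : ∀ n : ℕ, c * q ^ n ≠ 1) (n : ℕ) : qPoch c q n ≠ 0 :=
  Finset.prod_ne_zero_iff.mpr fun k _ => sub_ne_zero.mpr (hc k).symm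

lemma mul_pow_ne_one {q z : ℂ} (hq : ‖q‖ < 1) (hz : ‖z‖ < 1) (n : ℕ) : z * q ^ n ≠ 1 := by
  intro h
  have h1 : ‖z * q ^ n‖ = 1 := by rw [h, norm_one]
  rw [norm_mul, norm_pow] at h1
  nlinarith [pow_le_one₀ (n := n) (norm_nonneg q) hq.le, norm_nonneg z,
    pow_nonneg (norm_nonneg q) n]

lemma mul_pow_shift_ne_one {c q : ℂ} (hc : ∀ n : ℕ, c * q ^ n ≠ 1) (k n : ℕ) :
    c * q ^ k * q ^ n ≠ 1 := by
  rw [mul_assoc, ← pow_add]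
  exact hc _

lemma mul_shift_ne_one {c q : ℂ} (hc : ∀ n : ℕ, c * q ^ n ≠ 1) (n : ℕ) : c * q * q ^ n ≠ 1 := by
  simpa using mul_pow_shift_ne_one hc 1 n

lemma exists_tendsto_qPoch (a : ℂ) {q : ℂ} (hq : ‖q‖ < 1) :
    ∃ l, Tendsto (qPoch a q) atTop (𝓝 l) ∧ ((∀ n : ℕ, a * q ^ n ≠ 1) → l ≠ 0) := by
  have hs : Summable fun n : ℕ => ‖-(a * q ^ n)‖ := by
    simpa [norm_mul, norm_pow] using
      (summable_geometric_of_lt_one (norm_nonneg q) hq).mul_left ‖a‖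
  refine ⟨_, ((multipliable_one_add_of_summable hs).hasProd.tendsto_prod_nat).congr fun n => ?_,
    fun h => tprod_one_add_ne_zero_of_summable (fun n => ?_) hs⟩
  · exact Finset.prod_congr rfl fun k _ => (sub_eq_add_neg _ _).symm
  · rw [← sub_eq_add_neg]
    exact sub_ne_zero.mpr (h n).symm

lemma qPoch_bounded (a : ℂ) {q : ℂ} (hq : ‖q‖ < 1) : ∃ K, 0 < K ∧ ∀ n, ‖qPoch a q n‖ ≤ K := by
  obtain ⟨l, hl, -⟩ := exists_tendsto_qPoch a hq
  obtain ⟨K, hK⟩ := hl.norm.bddAbove_range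
  exact ⟨max K 1, by positivity, fun n => (hK ⟨n, rfl⟩).trans (le_max_left _ _)⟩

lemma qPoch_inv_bounded {a q : ℂ} (hq : ‖q‖ < 1) (ha : ∀ n : ℕ, a * q ^ n ≠ 1) :
    ∃ K, 0 < K ∧ ∀ n, ‖(qPoch a q n)⁻¹‖ ≤ K := by
  obtain ⟨l, hl, h0⟩ := exists_tendsto_qPoch a hq
  obtain ⟨K, hK⟩ := (hl.inv₀ (h0 ha)).norm.bddAbove_range
  exact ⟨max K 1, by positivity, fun n => (hK ⟨n, rfl⟩).trans (le_max_left _ _)⟩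

/-! ### The series -/

/-- The factors `(b q ^ k; q)_n` are bounded uniformly in `k` and `n`. -/
lemma qPoch_shift_bounded (b : ℂ) {q : ℂ} (hq : ‖q‖ < 1) :
    ∃ K, 0 < K ∧ ∀ k n, ‖qPoch (b * q ^ k) q n‖ ≤ K := by
  refine ⟨Real.exp (∑' i, ‖b‖ * ‖q‖ ^ i), Real.exp_pos _, fun k n => ?_⟩
  have hs := (summable_geometric_of_lt_one (norm_nonneg q) hq).mul_left ‖b‖
  calc ‖qPoch (b * q ^ k) q n‖ ≤ ∏ i ∈ Finset.range n, (1 + ‖b‖ * ‖q‖ ^ i) := by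
        rw [qPoch, norm_prod]
        refine Finset.prod_le_prod (fun _ _ => norm_nonneg _) fun i _ => ?_
        refine (norm_sub_le _ _).trans ?_
        rw [norm_one, norm_mul, norm_mul, norm_pow, norm_pow]
        gcongr
        exact mul_le_of_le_one_right (norm_nonneg _) (pow_le_one₀ (norm_nonneg _) hq.le)
    _ ≤ Real.exp (∑ i ∈ Finset.range n, ‖b‖ * ‖q‖ ^ i) :=
        Real.prod_one_add_le_exp_sum _ fun i => by positivity
    _ ≤ _ := Real.exp_le_exp.mpr (hs.sum_le_tsum _ fun i _ => by positivity)

/-- A bound on the terms which is uniform in the shifts of the parameters `b`, `c`. -/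
lemma phiTerm_bounded (a b : ℂ) {c q : ℂ} (hq : ‖q‖ < 1) (hc : ∀ n : ℕ, c * q ^ n ≠ 1) :
    ∃ K, ∀ (j k n : ℕ) (w : ℂ),
      ‖phiTerm a (b * q ^ j) (c * q ^ k) q w n‖ ≤ K * ‖w‖ ^ n := by
  obtain ⟨A, hA, hA'⟩ := qPoch_bounded a hq
  obtain ⟨B, hB, hB'⟩ := qPoch_shift_bounded b hq
  obtain ⟨C, hC, hC'⟩ := qPoch_bounded c hq
  obtain ⟨D, hD, hD'⟩ := qPoch_inv_bounded hq hc
  obtain ⟨E, hE, hE'⟩ := qPoch_inv_bounded hq (mul_pow_ne_one hq hq)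
  refine ⟨A * B * (C * D * E), fun j k n w => ?_⟩
  -- Writing 1/(cq^k;q)_n as (c;q)_k / (c;q)_{k+n} makes the bound uniform in k.
  have e : phiTerm a (b * q ^ j) (c * q ^ k) q w n = qPoch a q n * qPoch (b * q ^ j) q n *
      (qPoch c q k * (qPoch c q (k + n))⁻¹ * (qPoch q q n)⁻¹) * w ^ n := by
    have h := qPoch_ne_zero hc k
    rw [phiTerm, qPoch_add, div_eq_mul_inv, mul_inv, mul_inv, mul_inv_cancel_left₀ h]
  rw [e]
  simp only [norm_mul, norm_pow]
  gcongr
  exacts [hA' n, hB' j n, hC' k, hD' (k + n), hE' n]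

lemma summable_phiTerm (a b : ℂ) {c q z : ℂ} (hq : ‖q‖ < 1) (hz : ‖z‖ < 1)
    (hc : ∀ n : ℕ, c * q ^ n ≠ 1) : Summable (phiTerm a b c q z) := by
  obtain ⟨K, hK⟩ := phiTerm_bounded a b hq hc
  refine Summable.of_norm_bounded
    ((summable_geometric_of_lt_one (norm_nonneg z) hz).mul_left K) fun n => ?_
  simpa using hK 0 0 n z

@[simp] lemma phiTerm_zero (a b c q z : ℂ) : phiTerm a b c q z 0 = 1 := by simp [phiTerm]

/-- As the parameters are shifted, the series tends to `1`. -/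
lemma tendsto_phi_shift (a b : ℂ) {c q z : ℂ} (hq : ‖q‖ < 1) (hz : ‖z‖ < 1)
    (hc : ∀ n : ℕ, c * q ^ n ≠ 1) (i : ℕ) :
    Tendsto (fun k => phi a (b * q ^ (k + i)) (c * q ^ (k + i)) q (z * q ^ k)) atTop (𝓝 1) := by
  obtain ⟨K, hK⟩ := phiTerm_bounded a b hq hc
  have hK0 : 0 ≤ K := (norm_nonneg _).trans (by simpa only [pow_zero, mul_one] using hK 0 0 0 0)
  have hw : Tendsto (fun k : ℕ => ‖z * q ^ k‖) atTop (𝓝 0) := by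
    simpa using ((tendsto_pow_atTop_nhds_zero_of_norm_lt_one hq).const_mul z).norm
  -- Only the constant term survives termwise; dominated convergence applies with majorant K|z|^n.
  have h1 : (1 : ℂ) = ∑' n : ℕ, if n = 0 then 1 else 0 := (tsum_ite_eq 0 fun _ => (1 : ℂ)).symm
  rw [h1]
  refine tendsto_tsum_of_dominated_convergence
    ((summable_geometric_of_lt_one (norm_nonneg z) hz).mul_left K) (fun n => ?_)
    (Eventually.of_forall fun k n => (hK _ _ n _).trans ?_)
  · by_cases hn : n = 0
    · subst hn; simp
    · rw [if_neg hn]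
      refine squeeze_zero_norm (fun k => hK _ _ n _) ?_
      simpa [hn] using (hw.pow n).const_mul K
  · rw [norm_mul, norm_pow]
    gcongr
    exact mul_le_of_le_one_right (norm_nonneg _) (pow_le_one₀ (norm_nonneg _) hq.le)

/-! ### Contiguous relations -/

lemma phiTerm_mul_pow (a b c q z : ℂ) (n : ℕ) :
    phiTerm a b c q (z * q) n = phiTerm a b c q z n * q ^ n := by
  simp only [phiTerm, mul_pow]
  ring

lemma norm_mul_lt_one {q z : ℂ} (hq : ‖q‖ < 1) (hz : ‖z‖ < 1) : ‖z * q‖ < 1 := by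
  rw [norm_mul]
  nlinarith [norm_nonneg z, norm_nonneg q]

lemma one_sub_mul_pow_ne_zero {c q : ℂ} (hc : ∀ n : ℕ, c * q ^ n ≠ 1) (n : ℕ) :
    1 - c * q ^ n ≠ 0 := sub_ne_zero.mpr (hc n).symm

lemma phiTerm_succ (a b c q z : ℂ) (n : ℕ) :
    phiTerm a b c q z (n + 1) = phiTerm a b c q z n *
      ((1 - a * q ^ n) * (1 - b * q ^ n) * z / ((1 - c * q ^ n) * (1 - q * q ^ n))) := by
  simp only [phiTerm, qPoch_succ, pow_succ, div_eq_mul_inv, mul_inv]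
  ring

/-- Both sides come from (1-b)(bq;q)_n = (b;q)_n(1-bq^n) and its analogue for c. Keeping 1 - b as a
factor covers b = 1. -/
lemma phiTerm_shift (a b : ℂ) {c q : ℂ} (hc : ∀ n : ℕ, c * q ^ n ≠ 1) (z : ℂ) (n : ℕ) :
    (1 - b) * phiTerm a (b * q) (c * q) q z n * (1 - c * q ^ n) =
      (1 - c) * phiTerm a b c q z n * (1 - b * q ^ n) := by
  have hb := (qPoch_succ b q n).symm.trans (qPoch_succ' b q n)
  have hc' := (qPoch_succ c q n).symm.trans (qPoch_succ' c q n)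
  have h1 := qPoch_ne_zero hc n
  have h2 := qPoch_ne_zero (mul_shift_ne_one hc) n
  have e : (1 - b) * qPoch (b * q) q n * ((1 - c * q ^ n) * (qPoch (c * q) q n)⁻¹) =
      qPoch b q n * (1 - b * q ^ n) * ((1 - c) * (qPoch c q n)⁻¹) := by
    rw [hb]
    congr 1
    field_simp
    linear_combination hc'
  simp only [phiTerm, div_eq_mul_inv, mul_inv]
  linear_combination (qPoch a q n * (qPoch q q n)⁻¹ * z ^ n) * e

/-- Contiguous relation between `φ(b; c; z)`, `φ(bq; cq; z)` and `φ(bq; cq; zq)`. -/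
lemma phi_contiguous_left (a b : ℂ) {c q z : ℂ} (hq : ‖q‖ < 1) (hz : ‖z‖ < 1)
    (hc : ∀ n : ℕ, c * q ^ n ≠ 1) :
    (1 - c) * phi a b c q z = (1 - b * z) * phi a (b * q) (c * q) q z
      - (c - a * b * z) * phi a (b * q) (c * q) q (z * q) := by
  have s0 := summable_phiTerm a b hq hz hc
  have s1 := summable_phiTerm a (b * q) hq hz (mul_shift_ne_one hc)
  have s2 := summable_phiTerm a (b * q) hq (norm_mul_lt_one hq hz) (mul_shift_ne_one hc)
  have t0 := s0.tsum_eq_zero_add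
  have t1 := s1.tsum_eq_zero_add
  have t2 := s2.tsum_eq_zero_add
  -- The relation is compared at each power z^(n+1); the constant terms agree separately.
  have key : ∀ n, (1 - c) * phiTerm a b c q z (n + 1) =
      phiTerm a (b * q) (c * q) q z (n + 1) - c * phiTerm a (b * q) (c * q) q (z * q) (n + 1)
      - b * z * phiTerm a (b * q) (c * q) q z n
      + a * b * z * phiTerm a (b * q) (c * q) q (z * q) n := by
    intro n
    have h1 := one_sub_mul_pow_ne_zero hc n
    have h2 := one_sub_mul_pow_ne_zero (mul_shift_ne_one hc) n
    have h3 := one_sub_mul_pow_ne_zero (mul_pow_ne_one hq hq) n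
    have e0 : (1 - c) * phiTerm a b c q z (n + 1) = (1 - b) * phiTerm a (b * q) (c * q) q z n *
        ((1 - a * q ^ n) * z / (1 - q * q ^ n)) := by
      have := phiTerm_shift a b hc z n
      rw [phiTerm_succ]
      generalize q ^ n = x at *
      generalize hd : 1 - q * x = d at *
      field_simp
      linear_combination (-(z * (1 - a * x))) * this
    rw [e0, phiTerm_mul_pow, phiTerm_mul_pow, phiTerm_succ]
    generalize phiTerm a (b * q) (c * q) q z n = T
    rw [pow_succ]
    generalize q ^ n = x at *
    generalize he : 1 - c * q * x = e at *
    generalize hd : 1 - q * x = d at *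
    field_simp
    simp only [← he, ← hd]
    ring
  have S : (1 - c) * ∑' n, phiTerm a b c q z (n + 1) =
      ∑' n, phiTerm a (b * q) (c * q) q z (n + 1)
      - c * ∑' n, phiTerm a (b * q) (c * q) q (z * q) (n + 1)
      - b * z * ∑' n, phiTerm a (b * q) (c * q) q z n
      + a * b * z * ∑' n, phiTerm a (b * q) (c * q) q (z * q) n := by
    rw [← tsum_mul_left, tsum_congr key]
    exact ((((s1.comp_injective Nat.succ_injective).hasSum.sub
      ((s2.comp_injective Nat.succ_injective).hasSum.mul_left c)).sub
        (s1.hasSum.mul_left (b * z))).add (s2.hasSum.mul_left (a * b * z))).tsum_eq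
  simp only [phi]
  simp only [phiTerm_zero] at t0 t1 t2
  linear_combination (1 - c) * t0 - t1 + c * t2 + S

/-- Contiguous relation between `φ(b; c; z)`, `φ(b; c; zq)` and `φ(bq; cq; zq)`. -/
lemma phi_contiguous_right (a b : ℂ) {c q z : ℂ} (hq : ‖q‖ < 1) (hz : ‖z‖ < 1)
    (hc : ∀ n : ℕ, c * q ^ n ≠ 1) :
    (1 - z) * phi a b c q z = (1 - b * z) * phi a b c q (z * q)
      + (1 - b) * (c - a) * z / (1 - c) * phi a (b * q) (c * q) q (z * q) := by
  have s0 := summable_phiTerm a b hq hz hc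
  have s1 := summable_phiTerm a b hq (norm_mul_lt_one hq hz) hc
  have s2 := summable_phiTerm a (b * q) hq (norm_mul_lt_one hq hz) (mul_shift_ne_one hc)
  have t0 := s0.tsum_eq_zero_add
  have t1 := s1.tsum_eq_zero_add
  have key : ∀ n, phiTerm a b c q z (n + 1) = phiTerm a b c q (z * q) (n + 1)
      + z * phiTerm a b c q z n - b * z * phiTerm a b c q (z * q) n
      + (1 - b) * (c - a) * z / (1 - c) * phiTerm a (b * q) (c * q) q (z * q) n := by
    intro n
    have h0 : 1 - c ≠ 0 := by simpa using one_sub_mul_pow_ne_zero hc 0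
    have h1 := one_sub_mul_pow_ne_zero hc n
    have h3 := one_sub_mul_pow_ne_zero (mul_pow_ne_one hq hq) n
    have e0 : (1 - b) * (c - a) * z / (1 - c) * (phiTerm a (b * q) (c * q) q z n * q ^ n) =
        phiTerm a b c q z n * ((c - a) * z * q ^ n * (1 - b * q ^ n) / (1 - c * q ^ n)) := by
      have := phiTerm_shift a b hc z n
      generalize q ^ n = x at *
      generalize hd : 1 - c * x = d at *
      field_simp
      linear_combination (z * x * (c - a)) * this
    rw [phiTerm_mul_pow, phiTerm_mul_pow, phiTerm_mul_pow, e0, phiTerm_succ]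
    generalize phiTerm a b c q z n = T
    rw [pow_succ]
    generalize q ^ n = x at *
    generalize he : 1 - c * x = e at *
    generalize hd : 1 - q * x = d at *
    field_simp
    simp only [← he, ← hd]
    ring
  have S : ∑' n, phiTerm a b c q z (n + 1) = ∑' n, phiTerm a b c q (z * q) (n + 1)
      + z * ∑' n, phiTerm a b c q z n - b * z * ∑' n, phiTerm a b c q (z * q) n
      + (1 - b) * (c - a) * z / (1 - c) * ∑' n, phiTerm a (b * q) (c * q) q (z * q) n := by
    rw [tsum_congr key]
    exact ((((s1.comp_injective Nat.succ_injective).hasSum.add (s0.hasSum.mul_left z)).sub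
      (s1.hasSum.mul_left (b * z))).add (s2.hasSum.mul_left _)).tsum_eq
  simp only [phi]
  simp only [phiTerm_zero] at t0 t1
  linear_combination t0 - t1 + S

/-! ### The tail sequence -/

/-- The normalized series with even index in the three-term recurrence. -/
noncomputable def evenTail (a b c q z : ℂ) (k : ℕ) : ℂ :=
  phi a (b * q ^ k) (c * q ^ k) q (z * q ^ k) / (qPoch c q k * qPoch z q k)

/-- The normalized series with odd index in the three-term recurrence. -/
noncomputable def oddTail (a b c q z : ℂ) (k : ℕ) : ℂ :=
  phi a (b * q ^ (k + 1)) (c * q ^ (k + 1)) q (z * q ^ k) / (qPoch c q (k + 1) * qPoch z q k)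

/-- This is the left relation at (bq^k, cq^k, zq^k), divided by (c;q)_{k+1}(z;q)_k. The factor zq^k
- 1 compensates for (z;q)_{k+1} in the next even entry. -/
lemma evenTail_eq (a b : ℂ) {c q z : ℂ} (hq : ‖q‖ < 1) (hz : ‖z‖ < 1)
    (hc : ∀ n : ℕ, c * q ^ n ≠ 1) (k : ℕ) :
    evenTail a b c q z k = (1 - b * z * q ^ (2 * k)) * oddTail a b c q z k
      + (c - a * b * z * q ^ k) * (z * q ^ k - 1) * q ^ k * evenTail a b c q z (k + 1) := by
  have hzk : ‖z * q ^ k‖ < 1 := by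
    rw [norm_mul, norm_pow]
    nlinarith [norm_nonneg z, pow_le_one₀ (n := k) (norm_nonneg q) hq.le,
      pow_nonneg (norm_nonneg q) k]
  have h := phi_contiguous_left a (b * q ^ k) hq hzk (mul_pow_shift_ne_one hc k)
  have h1 := qPoch_ne_zero hc k
  have h2 := qPoch_ne_zero (mul_pow_ne_one hq hz) k
  have h3 := one_sub_mul_pow_ne_zero hc k
  have h4 := one_sub_mul_pow_ne_zero (mul_pow_ne_one hq hz) k
  have e : z * q ^ k - 1 = -(1 - z * q ^ k) := by ring
  simp only [evenTail, oddTail, qPoch_succ, e]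
  simp only [mul_assoc _ (q ^ k) q, ← pow_succ] at h
  generalize phi a (b * q ^ k) (c * q ^ k) q (z * q ^ k) = P at *
  generalize phi a (b * q ^ (k + 1)) (c * q ^ (k + 1)) q (z * q ^ k) = Q at *
  generalize phi a (b * q ^ (k + 1)) (c * q ^ (k + 1)) q (z * q ^ (k + 1)) = R at *
  rw [mul_comm 2 k, pow_mul]
  generalize q ^ k = x at *
  generalize hd : 1 - c * x = d at *
  generalize he : 1 - z * x = e at *
  field_simp
  linear_combination h

/-- This is the right relation at (bq^(k+1), cq^(k+1), zq^k), divided by (c;q)_{k+1}(z;q)_{k+1}; its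
denominator 1 - cq^(k+1) is absorbed into (c;q)_{k+2}. -/
lemma oddTail_eq (a b : ℂ) {c q z : ℂ} (hq : ‖q‖ < 1) (hz : ‖z‖ < 1)
    (hc : ∀ n : ℕ, c * q ^ n ≠ 1) (k : ℕ) :
    oddTail a b c q z k = (1 - b * z * q ^ (2 * k + 1)) * evenTail a b c q z (k + 1)
      + (1 - b * q ^ (k + 1)) * (c * q ^ (k + 1) - a) * z * q ^ k * oddTail a b c q z (k + 1) := by
  have hzk : ‖z * q ^ k‖ < 1 := by
    rw [norm_mul, norm_pow]
    nlinarith [norm_nonneg z, pow_le_one₀ (n := k) (norm_nonneg q) hq.le,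
      pow_nonneg (norm_nonneg q) k]
  have h := phi_contiguous_right a (b * q ^ (k + 1)) hq hzk (mul_pow_shift_ne_one hc (k + 1))
  have h1 := qPoch_ne_zero hc (k + 1)
  have h2 := qPoch_ne_zero (mul_pow_ne_one hq hz) k
  have h3 := one_sub_mul_pow_ne_zero hc (k + 1)
  have h4 := one_sub_mul_pow_ne_zero (mul_pow_ne_one hq hz) k
  simp only [evenTail, oddTail, qPoch_succ c q (k + 1), qPoch_succ z q k]
  simp only [mul_assoc _ (q ^ (k + 1)) q, mul_assoc _ (q ^ k) q, ← pow_succ] at h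
  generalize phi a (b * q ^ (k + 1)) (c * q ^ (k + 1)) q (z * q ^ k) = P at *
  generalize phi a (b * q ^ (k + 1)) (c * q ^ (k + 1)) q (z * q ^ (k + 1)) = Q at *
  generalize phi a (b * q ^ (k + 1 + 1)) (c * q ^ (k + 1 + 1)) q (z * q ^ (k + 1)) = R at *
  generalize qPoch c q (k + 1) = C at *
  have e : q ^ (2 * k + 1) = q ^ (k + 1) * q ^ k := by ring
  rw [e]
  generalize q ^ (k + 1) = y at *
  generalize q ^ k = x at *
  generalize hd : 1 - c * y = d at *
  generalize he : 1 - z * x = e at *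
  field_simp at h ⊢
  linear_combination h

lemma tendsto_of_even_of_odd {X : Type*} [TopologicalSpace X] {f : ℕ → X} {l : X}
    (h0 : Tendsto (fun k => f (2 * k)) atTop (𝓝 l))
    (h1 : Tendsto (fun k => f (2 * k + 1)) atTop (𝓝 l)) : Tendsto f atTop (𝓝 l) := by
  rw [tendsto_def]
  intro s hs
  obtain ⟨M, hM⟩ := mem_atTop_sets.mp (h0 hs)
  obtain ⟨N, hN⟩ := mem_atTop_sets.mp (h1 hs)
  refine mem_atTop_sets.mpr ⟨2 * M + 2 * N, fun n hn => ?_⟩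
  obtain ⟨k, rfl | rfl⟩ := n.even_or_odd'
  · exact hM k (by omega)
  · exact hN k (by omega)

lemma tendsto_evenTail (a b : ℂ) {c q z lc lz : ℂ} (hq : ‖q‖ < 1) (hz : ‖z‖ < 1)
    (hc : ∀ n : ℕ, c * q ^ n ≠ 1) (hlc : Tendsto (qPoch c q) atTop (𝓝 lc))
    (hlz : Tendsto (qPoch z q) atTop (𝓝 lz)) (h : lc * lz ≠ 0) :
    Tendsto (evenTail a b c q z) atTop (𝓝 (1 / (lc * lz))) :=
  (tendsto_phi_shift a b hq hz hc 0).div (hlc.mul hlz) h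

lemma tendsto_oddTail (a b : ℂ) {c q z lc lz : ℂ} (hq : ‖q‖ < 1) (hz : ‖z‖ < 1)
    (hc : ∀ n : ℕ, c * q ^ n ≠ 1) (hlc : Tendsto (qPoch c q) atTop (𝓝 lc))
    (hlz : Tendsto (qPoch z q) atTop (𝓝 lz)) (h : lc * lz ≠ 0) :
    Tendsto (oddTail a b c q z) atTop (𝓝 (1 / (lc * lz))) :=
  (tendsto_phi_shift a b hq hz hc 1).div ((hlc.comp (tendsto_add_atTop_nat 1)).mul hlz) h

/-- The tail sequence of the continued fraction. The entry with index `1` is rescaled, as are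
`β_1` and `α_2`. -/
noncomputable def tail (a b c q z : ℂ) (n : ℕ) : ℂ :=
  if n = 1 then (1 - c) * oddTail a b c q z 0
  else if n % 2 = 0 then evenTail a b c q z (n / 2) else oddTail a b c q z (n / 2)

lemma tail_even (a b c q z : ℂ) (k : ℕ) : tail a b c q z (2 * k) = evenTail a b c q z k := by
  have h1 : 2 * k ≠ 1 := by omega
  simp [tail, h1]

lemma tail_odd (a b c q z : ℂ) (k : ℕ) :
    tail a b c q z (2 * k + 3) = oddTail a b c q z (k + 1) := by
  have h1 : (2 * k + 3) % 2 = 1 := by omega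
  have h2 : (2 * k + 3) / 2 = k + 1 := by omega
  simp [tail, h1, h2]

lemma tail_one (a b c q z : ℂ) : tail a b c q z 1 = (1 - c) * oddTail a b c q z 0 := if_pos rfl

lemma partialNum_odd (a b c q z : ℂ) (k : ℕ) : partialNum a b c q z (2 * k + 1) =
    (c - a * b * z * q ^ k) * (z * q ^ k - 1) * q ^ k := by
  have h1 : (2 * k + 1) % 2 = 1 := by omega
  have h2 : (2 * k + 1) / 2 = k := by omega
  simp only [partialNum, h1, h2, if_true]

lemma partialNum_even (a b c q z : ℂ) (k : ℕ) : partialNum a b c q z (2 * k + 2) =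
    (if k = 0 then 1 - c else 1) *
      ((1 - b * q ^ (k + 1)) * (c * q ^ (k + 1) - a) * z * q ^ k) := by
  have h1 : (2 * k + 2) % 2 = 0 := by omega
  have h2 : (2 * k + 2) / 2 = k + 1 := by omega
  simp [partialNum, h1, h2]

/-- Multiplying entry 1 by 1 - c turns it into the series itself. The equivalence transformation
divides β_0 by 1 - c and multiplies β_1 and α_2 by it, which explains the exceptional coefficients.
-/
lemma tail_recurrence (a b : ℂ) {c q z : ℂ} (hq : ‖q‖ < 1) (hz : ‖z‖ < 1)
    (hc : ∀ n : ℕ, c * q ^ n ≠ 1) (n : ℕ) :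
    tail a b c q z n = partialDen b c q z n * tail a b c q z (n + 1)
      + partialNum a b c q z (n + 1) * tail a b c q z (n + 2) := by
  obtain ⟨k, rfl | rfl⟩ := n.even_or_odd'
  · have h := evenTail_eq a b hq hz hc k
    rw [partialNum_odd, show 2 * k + 2 = 2 * (k + 1) by ring, tail_even, tail_even, h]
    congr 1
    rcases k with _ | k
    · have h0 : 1 - c ≠ 0 := by simpa using one_sub_mul_pow_ne_zero hc 0
      simp only [mul_zero, pow_zero, mul_one, zero_add, tail_one, partialDen]
      field_simp
    · rw [show 2 * (k + 1) = 2 * k + 2 by ring, tail_odd]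
      rfl
  · have h := oddTail_eq a b hq hz hc k
    rw [partialNum_even, show 2 * k + 1 + 1 = 2 * (k + 1) by ring, tail_even,
      show 2 * k + 1 + 2 = 2 * k + 3 by ring, tail_odd]
    rcases k with _ | k
    · simp only [mul_zero, pow_zero, mul_one, zero_add, tail_one, partialDen, if_true, pow_one]
        at h ⊢
      rw [h]
      ring
    · rw [show 2 * (k + 1) + 1 = 2 * k + 3 by ring, tail_odd, h]
      simp only [Nat.add_eq_zero_iff, one_ne_zero, and_false, if_false, one_mul]
      rfl

lemma tendsto_tail (a b : ℂ) {c q z : ℂ} (hq : ‖q‖ < 1) (hz : ‖z‖ < 1)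
    (hc : ∀ n : ℕ, c * q ^ n ≠ 1) : ∃ L ≠ 0, Tendsto (tail a b c q z) atTop (𝓝 L) := by
  obtain ⟨lc, hlc, hc0⟩ := exists_tendsto_qPoch c hq
  obtain ⟨lz, hlz, hz0⟩ := exists_tendsto_qPoch z hq
  have h := mul_ne_zero (hc0 hc) (hz0 (mul_pow_ne_one hq hz))
  refine ⟨1 / (lc * lz), one_div_ne_zero h, tendsto_of_even_of_odd ?_ ?_⟩
  · simp only [tail_even]
    exact tendsto_evenTail a b hq hz hc hlc hlz h
  -- Index 1 is skipped, being the rescaled entry.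
  · rw [← tendsto_add_atTop_iff_nat 1]
    have e : ∀ k, tail a b c q z (2 * (k + 1) + 1) = oddTail a b c q z (k + 1) :=
      fun k => tail_odd a b c q z k
    simp only [e]
    exact (tendsto_oddTail a b hq hz hc hlc hlz h).comp (tendsto_add_atTop_nat 1)

/-! ### Summability of the coefficients and the main theorem -/

lemma norm_sub_mul_pow_le (x y : ℂ) {q : ℂ} (hq : ‖q‖ < 1) (k : ℕ) :
    ‖x - y * q ^ k‖ ≤ ‖x‖ + ‖y‖ := by
  refine (norm_sub_le _ _).trans ?_
  rw [norm_mul, norm_pow]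
  gcongr
  exact mul_le_of_le_one_right (norm_nonneg _) (pow_le_one₀ (norm_nonneg _) hq.le)

lemma summable_coefficients (a b c : ℂ) {q : ℂ} (z : ℂ) (hq : ‖q‖ < 1) :
    Summable fun n => ‖partialDen b c q z (n + 1) - 1‖ + ‖partialNum a b c q z (n + 1)‖ := by
  have hg := summable_geometric_of_lt_one (norm_nonneg q) hq
  refine Summable.add ?_ (Summable.even_add_odd ?_ ?_)
  · rw [← summable_nat_add_iff 1]
    refine (((summable_nat_add_iff 2).mpr hg).mul_left ‖b * z‖).congr fun n => ?_
    have : partialDen b c q z (n + 1 + 1) - 1 = -(b * z * q ^ (n + 2)) := by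
      simp only [partialDen]; ring
    simp only [this, norm_neg, norm_mul, norm_pow]
  · refine Summable.of_nonneg_of_le (fun _ => norm_nonneg _) (fun k => ?_)
      (hg.mul_left ((‖c‖ + ‖a * b * z‖) * (‖(1 : ℂ)‖ + ‖z‖)))
    rw [partialNum_odd, norm_mul, norm_mul, norm_pow, norm_sub_rev (z * q ^ k)]
    gcongr
    exacts [norm_sub_mul_pow_le _ _ hq k, norm_sub_mul_pow_le _ _ hq k]
  · refine Summable.of_nonneg_of_le (fun _ => norm_nonneg _) (fun k => ?_)
      -- The constant ‖1 - c‖ + 1 dominates both the extra factor 1 - c in α_2 and the factor 1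
      -- elsewhere.
      (hg.mul_left ((‖1 - c‖ + 1) * ((‖(1 : ℂ)‖ + ‖b‖) * (‖a‖ + ‖c‖) * ‖z‖)))
    rw [show 2 * k + 1 + 1 = 2 * k + 2 by ring, partialNum_even, norm_mul, norm_mul, norm_mul,
      norm_mul, norm_pow, norm_sub_rev (c * q ^ (k + 1)), ← mul_assoc]
    gcongr
    · split_ifs
      · linarith
      · simp
    exacts [norm_sub_mul_pow_le _ _ hq _, norm_sub_mul_pow_le _ _ hq _]

end HeineCF

theorem mainTheorem2 (a b c q z : ℂ) (hq : ‖q‖ < 1) (hz : ‖z‖ < 1) (hb : b ≠ 0)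
    (hcb : ‖c / b‖ < 1) (hc : ∀ n : ℕ, c * q ^ n ≠ 1) :
    Summable (HeineCF.phiTerm a b c q z) ∧
    Summable (HeineCF.phiTerm a (b * q) (c * q) q z) ∧
    ((∀ n : ℕ, 1 ≤ n → HeineCF.partialNum a b c q z n ≠ 0) →
      HeineCF.phi a b c q z ≠ 0 ∨ HeineCF.phi a (b * q) (c * q) q z ≠ 0) ∧
    (HeineCF.phi a b c q z ≠ 0 ∨ HeineCF.phi a (b * q) (c * q) q z ≠ 0 →
      HeineCF.CFConvergesTo (HeineCF.partialNum a b c q z) (HeineCF.partialDen b c q z)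
        (HeineCF.sphereDiv (HeineCF.phi a b c q z) (HeineCF.phi a (b * q) (c * q) q z))) := by
  have h0 : 1 - c ≠ 0 := by simpa using HeineCF.one_sub_mul_pow_ne_zero hc 0
  have e0 : HeineCF.tail a b c q z 0 = HeineCF.phi a b c q z := by
    simpa [HeineCF.evenTail] using HeineCF.tail_even a b c q z 0
  have e1 : HeineCF.tail a b c q z 1 = HeineCF.phi a (b * q) (c * q) q z := by
    rw [HeineCF.tail_one, HeineCF.oddTail, HeineCF.qPoch_succ]
    simp [mul_div_cancel₀, h0]
  obtain ⟨L, hL0, hL⟩ := HeineCF.tendsto_tail a b hq hz hc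
  have hrec := HeineCF.tail_recurrence a b hq hz hc
  rw [← e0, ← e1]
  exact ⟨HeineCF.summable_phiTerm a b hq hz hc,
    HeineCF.summable_phiTerm a (b * q) hq hz (HeineCF.mul_shift_ne_one hc),
    fun hα => HeineCF.tail_ne_zero hrec hL hL0 fun n => hα (n + 1) (by omega),
    HeineCF.cfConvergesTo_of_tail hrec hL hL0 (HeineCF.summable_coefficients a b c z hq)⟩
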